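/- **Setting.** A *generic configuration* $\xi=(L^\xi,\Delta_0^\xi,B^\xi,d,G)$ consists of the following. 1. $L^\xi$ is a first-order language with equality, with symbols $0,1,2,\le$ and $\mathrm{Max}$, possibly further symbols, a fixed standard model with universe $\mathbb N$ (called Standard-M), and, for each $k\in\mathbb N$, a closed term $T_k$ with value $k$. Bounded quantifiers $\forall v\le t$, $\exists v\le t$ are distinguished syntactically from unbounded ones. 2. $\Delta_0^\xi$ is a class of formulas all of whose quantifiers are bounded. It is closed under negation and contains formulas that define the graphs of addition and multiplication in Standard-M. Put $\Pi_0^\xi=\Sigma_0^\xi=\Delta_0^\xi$. A $\Pi_{n+1}^\xi$ formula has the form $\forall v_1\cdots\forall v_k\,\Phi$ with $k\ge 0$ and $\Phi\in\Sigma_n^\xi$, and a $\Sigma_{n+1}^\xi$ formula has the form $\exists v_1\cdots\exists v_k\,\Phi$ with $k\ge0$ and $\Phi\in\Pi_n^\xi$. The negation of a $\Pi_n^\xi$ sentence is written as a $\Sigma_n^\xi$ sentence, by dualizing the quantifier prefix and negating the $\Delta_0^\xi$ matrix. 3. $B^\xi$ is a set of sentences that are true in Standard-M, and it proves every true $\Sigma_1^\xi$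 sentence. 4. $d$ is a method of deduction, that is, a set of formal proofs with a relation "$\pi$ is a $d$-proof of $\varphi$ from $\alpha$". For all axiom systems $\alpha\supseteq B^\xi$ it is complete (it proves from $\alpha$ every sentence that holds in all models of $\alpha$), and if it proves $X$, $Y$ and $(X\wedge Y)\to Z$ from $\alpha$, then it proves $Z$ from $\alpha$. 5. $G$ assigns Gödel numbers to formulas and to proofs, injectively. For $N\in\mathbb R\cup\{\infty\}$, a $\Pi_1^\xi$ or $\Sigma_1^\xi$ sentence is $\mathrm{Good}(N)$ if it is true in Standard-M once its unbounded quantifiers are restricted to the numbers $v<2^N$. For a set $\theta$ of $\Pi_1^\xi$ sentences, $\sharp(\theta)$ is the largest integer $J\ge 0$ such that all sentences of $\theta$ are $\mathrm{Good}(J)$ ($\infty$ if all $J$ qualify, $-\infty$ if none does). $\mathrm{Log}$ is the logarithm to base 2, with $\mathrm{Log}(0)=0$. The configuration is *EA-stable* if for every recursively enumerable set $\theta$ of $\Pi_1^\xi$ sentences, and every $p$ with $\mathrm{Log}(p)\le\sharp(\theta)+1$ that is the Gödel number of a $d$-proof of a sentence $\Upsilon$ from $\theta\cup B^\xi$: *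 (A-stability) if $\Upsilon$ is $\Pi_1^\xi$, then $\Upsilon$ is $\mathrm{Good}\big(\tfrac12\sharp(\theta)\big)$; * (E-stability) if $\Upsilon$ is $\Sigma_1^\xi$, then $\Upsilon$ is $\mathrm{Good}\big(\tfrac12\lfloor\mathrm{Log}(p)\rfloor-1\big)$. A $\Pi_1^\xi$ sentence $\Psi=\forall x\,\forall y\,\forall p\,\forall q\;M(x,y,p,q)$ with $M\in\Delta_0^\xi$ *declares the Level$(1^\xi)$ consistency* of $\alpha$ if, for all $x,y,p,q\in\mathbb N$, $M(x,y,p,q)$ is true in Standard-M exactly when it is not the case that $x$ is the Gödel number of a $\Pi_1^\xi$ sentence, $y$ is that of the $\Sigma_1^\xi$ sentence which is its negation, and $p$ and $q$ are Gödel numbers of $d$-proofs from $\alpha$ of the sentences numbered $x$ and $y$. A sentence $\Phi$ is a $\mathrm{SelfCons}^1(B^\xi,d)$ sentence if $\Phi$ declares the Level$(1^\xi)$ consistency of $B^\xi\cup\{\Phi\}$, the system that contains $\Phi$ itself. An axiom system $\alpha$ is *self-justifying* if (i) one of its theorems declares its Level$(1^\xi)$ consistency, and (ii) $\alpha$ is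 consistent, that is, $d$ does not prove both $\varphi$ and $\neg\varphi$ from $\alpha$ for any sentence $\varphi$. **Theorem.** Let $\xi=(L^\xi,\Delta_0^\xi,B^\xi,d,G)$ be a generic configuration that is EA-stable. (1) Let $\mathrm{Neg}^1(x,y)$ and $\mathrm{SubstPrf}(g,t,p)$ be $\Delta_0^\xi$ formulas that define in Standard-M, respectively, the relation "$x$ is the Gödel number of a $\Pi_1^\xi$ sentence and $y$ that of its $\Sigma_1^\xi$ negation", and the relation "$g$ is the Gödel number of a formula $\gamma$ with one free variable and $p$ is that of a $d$-proof of the sentence numbered $t$ from $B^\xi\cup\{\gamma(T_g)\}$". Put $$\Gamma(g)=\forall x\,\forall y\,\forall p\,\forall q\;\neg\{\mathrm{Neg}^1(x,y)\wedge\mathrm{SubstPrf}(g,x,p)\wedge\mathrm{SubstPrf}(g,y,q)\},$$ let $n$ be the Gödel number of $\Gamma(g)$, and suppose that the sentence $\Gamma(T_n)$ is $\Pi_1^\xi$ (as is automatic when $\Delta_0^\xi$ is closed under conjunction and substitution). Then $\Gamma(T_n)$ is a $\mathrm{SelfCons}^1(B^\xi,d)$ sentence. (2) For every $\mathrm{SelfCons}^1(B^\xi,d)$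 sentence $\Phi$, the axiom system $B^\xi\cup\{\Phi\}$ is consistent, and it is self-justifying. -/

import Mathlib

/-! ### Arithmetic languages and their standard model -/

/-- A first-order language with symbols `0, 1, 2, Max, ≤` (equality is a logical symbol), possibly
with further function, constant and relation symbols, together with its standard model on `ℕ`, and
with a closed term `numeral k` that denotes `k`, for every natural number `k`. -/
structure ArithLanguage where
  lang : FirstOrder.Language.{0, 0}
  zero : lang.Functions 0
  one : lang.Functions 0
  two : lang.Functions 0
  max : lang.Functions 2
  le : lang.Relations 2
  std : lang.Structure ℕ
  std_zero : std.funMap zero ![] = 0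
  std_one : std.funMap one ![] = 1
  std_two : std.funMap two ![] = 2
  std_max : ∀ a b : ℕ, std.funMap max ![a, b] = Max.max a b
  std_le : ∀ a b : ℕ, std.RelMap le ![a, b] ↔ a ≤ b
  numeral : ℕ → lang.Term Empty
  numeral_value : ∀ k : ℕ,
    @FirstOrder.Language.Term.realize lang ℕ std Empty (fun e => e.elim) (numeral k) = k

/-- Standard-M, the standard model of the language. -/
instance ArithLanguage.instStd (L : ArithLanguage) : L.lang.Structure ℕ := L.std

/-- Formulas whose free variables are among `0, …, n - 1` (a quantifier binds the new variable
`n`). Bounded quantifiers `∀ v ≤ t` and `∃ v ≤ t` are primitive (and `v` does not occur in `t`), so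
that "unbounded quantifier" is a syntactic notion. -/
inductive Fml (L : ArithLanguage) : ℕ → Type
  | eq {n : ℕ} (s t : L.lang.Term (Fin n)) : Fml L n
  | rel {n k : ℕ} (R : L.lang.Relations k) (ts : Fin k → L.lang.Term (Fin n)) : Fml L n
  | not {n : ℕ} (φ : Fml L n) : Fml L n
  | and {n : ℕ} (φ ψ : Fml L n) : Fml L n
  | or {n : ℕ} (φ ψ : Fml L n) : Fml L n
  | imp {n : ℕ} (φ ψ : Fml L n) : Fml L n
  | ball {n : ℕ} (t : L.lang.Term (Fin n)) (φ : Fml L (n + 1)) : Fml L n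
  | bex {n : ℕ} (t : L.lang.Term (Fin n)) (φ : Fml L (n + 1)) : Fml L n
  | all {n : ℕ} (φ : Fml L (n + 1)) : Fml L n
  | ex {n : ℕ} (φ : Fml L (n + 1)) : Fml L n

/-- Sentences. -/
abbrev Sen (L : ArithLanguage) : Type := Fml L 0

namespace Fml

variable {L : ArithLanguage}

/-- All quantifiers of the formula are bounded. -/
def FullyBounded : {n : ℕ} → Fml L n → Prop
  | _, eq _ _ => True
  | _, rel _ _ => True
  | _, not φ => φ.FullyBounded
  | _, and φ ψ => φ.FullyBounded ∧ ψ.FullyBounded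
  | _, or φ ψ => φ.FullyBounded ∧ ψ.FullyBounded
  | _, imp φ ψ => φ.FullyBounded ∧ ψ.FullyBounded
  | _, ball _ φ => φ.FullyBounded
  | _, bex _ φ => φ.FullyBounded
  | _, all _ => False
  | _, ex _ => False

/-- Truth in a structure `M` at an assignment `v`, where the unbounded quantifiers range over
`D ⊆ M` only; the bounded quantifiers are not affected by `D`. -/
def HoldsIn {M : Type} [L.lang.Structure M] (D : Set M) :
    {n : ℕ} → Fml L n → (Fin n → M) → Prop
  | _, eq s t, v => s.realize v = t.realize v
  | _, rel R ts, v => FirstOrder.Language.Structure.RelMap R (fun i => (ts i).realize v)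
  | _, not φ, v => ¬ φ.HoldsIn D v
  | _, and φ ψ, v => φ.HoldsIn D v ∧ ψ.HoldsIn D v
  | _, or φ ψ, v => φ.HoldsIn D v ∨ ψ.HoldsIn D v
  | _, imp φ ψ, v => φ.HoldsIn D v → ψ.HoldsIn D v
  | _, ball t φ, v =>
      ∀ x : M, FirstOrder.Language.Structure.RelMap L.le ![x, t.realize v] →
        φ.HoldsIn D (Fin.snoc v x)
  | _, bex t φ, v =>
      ∃ x : M, FirstOrder.Language.Structure.RelMap L.le ![x, t.realize v] ∧
        φ.HoldsIn D (Fin.snoc v x)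
  | _, all φ, v => ∀ x ∈ D, φ.HoldsIn D (Fin.snoc v x)
  | _, ex φ, v => ∃ x ∈ D, φ.HoldsIn D (Fin.snoc v x)

/-- Truth in Standard-M at an assignment. -/
def StdHolds {n : ℕ} (φ : Fml L n) (v : Fin n → ℕ) : Prop :=
  φ.HoldsIn (Set.univ : Set ℕ) v

/-- A sentence that is true in Standard-M. -/
def StdTrue (φ : Sen L) : Prop := φ.StdHolds ![]

/-- A sentence that is true in the structure `M`. -/
def TrueIn (M : Type) [L.lang.Structure M] (φ : Sen L) : Prop :=
  φ.HoldsIn (Set.univ : Set M) ![]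

/-- The substitution `σ` under one further quantifier. -/
def liftSubst {n m : ℕ} (σ : Fin n → L.lang.Term (Fin m)) :
    Fin (n + 1) → L.lang.Term (Fin (m + 1)) :=
  Fin.snoc (α := fun _ => L.lang.Term (Fin (m + 1)))
    (fun i => (σ i).relabel Fin.castSucc) (FirstOrder.Language.Term.var (Fin.last m))

/-- Simultaneous substitution of terms for the free variables. -/
def subst : {n m : ℕ} → Fml L n → (Fin n → L.lang.Term (Fin m)) → Fml L m
  | _, _, eq s t, σ => eq (s.subst σ) (t.subst σ)
  | _, _, rel R ts, σ => rel R (fun i => (ts i).subst σ)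
  | _, _, not φ, σ => not (φ.subst σ)
  | _, _, and φ ψ, σ => and (φ.subst σ) (ψ.subst σ)
  | _, _, or φ ψ, σ => or (φ.subst σ) (ψ.subst σ)
  | _, _, imp φ ψ, σ => imp (φ.subst σ) (ψ.subst σ)
  | _, _, ball t φ, σ => ball (t.subst σ) (φ.subst (liftSubst σ))
  | _, _, bex t φ, σ => bex (t.subst σ) (φ.subst (liftSubst σ))
  | _, _, all φ, σ => all (φ.subst (liftSubst σ))
  | _, _, ex φ, σ => ex (φ.subst (liftSubst σ))

/-- Substitution of variables for the free variables. -/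
def rename {n m : ℕ} (φ : Fml L n) (f : Fin n → Fin m) : Fml L m :=
  φ.subst (fun i => FirstOrder.Language.Term.var (f i))

/-- The sentence `φ(ḡ)`, where `ḡ` is the numeral of `g`. -/
def atNumeral (φ : Fml L 1) (g : ℕ) : Sen L :=
  φ.subst (fun _ => (L.numeral g).relabel (fun e => e.elim))

/-- The negation of a prenex formula, in prenex form: the unbounded quantifiers of the prefix are
dualised and the fully bounded matrix is negated. -/
def dual : {n : ℕ} → Fml L n → Fml L n
  | _, all φ => ex φ.dual
  | _, ex φ => all φ.dual
  | _, φ => not φ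

end Fml

/-- A class of formulas, sorted by the number of free variables. -/
abbrev FmlClass (L : ArithLanguage) : Type := ∀ n : ℕ, Set (Fml L n)

/-- The formulas `∀ v₁ … ∀ vₖ Φ` with `k ≥ 0` and `Φ` in the class. -/
inductive AllPrefix {L : ArithLanguage} (C : FmlClass L) : ∀ n : ℕ, Fml L n → Prop
  | base {n : ℕ} {φ : Fml L n} (h : φ ∈ C n) : AllPrefix C n φ
  | all {n : ℕ} {φ : Fml L (n + 1)} (h : AllPrefix C (n + 1) φ) : AllPrefix C n φ.all

/-- The formulas `∃ v₁ … ∃ vₖ Φ` with `k ≥ 0` and `Φ` in the class. -/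
inductive ExPrefix {L : ArithLanguage} (C : FmlClass L) : ∀ n : ℕ, Fml L n → Prop
  | base {n : ℕ} {φ : Fml L n} (h : φ ∈ C n) : ExPrefix C n φ
  | ex {n : ℕ} {φ : Fml L (n + 1)} (h : ExPrefix C (n + 1) φ) : ExPrefix C n φ.ex

/-- The pair `(Π_k, Σ_k)` of classes built from `Δ = Π_0 = Σ_0`. -/
def fmlHierarchy {L : ArithLanguage} (Δ : FmlClass L) : ℕ → FmlClass L × FmlClass L
  | 0 => (Δ, Δ)
  | k + 1 => (fun n => {φ | AllPrefix (fmlHierarchy Δ k).2 n φ},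
      fun n => {φ | ExPrefix (fmlHierarchy Δ k).1 n φ})

/-- The `Π_k` formulas over `Δ`. -/
def PiClass {L : ArithLanguage} (Δ : FmlClass L) (k : ℕ) : FmlClass L := (fmlHierarchy Δ k).1

/-- The `Σ_k` formulas over `Δ`. -/
def SigmaClass {L : ArithLanguage} (Δ : FmlClass L) (k : ℕ) : FmlClass L := (fmlHierarchy Δ k).2

/-! ### Deduction, Gödel numbering, generic configurations -/

/-- Semantic consequence in first-order logic with equality. -/
def Entails {L : ArithLanguage} (α : Set (Sen L)) (φ : Sen L) : Prop :=
  ∀ (M : Type) [L.lang.Structure M] [Nonempty M], (∀ ψ ∈ α, ψ.TrueIn M) → φ.TrueIn M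

/-- A method of deduction: a type of formal proofs, and the relation "`π` is a proof of `φ` from
the axiom system `α`". -/
structure DeductionMethod (L : ArithLanguage) where
  Proof : Type
  IsProof : Set (Sen L) → Proof → Sen L → Prop

/-- `φ` is a theorem of `α`. -/
def DeductionMethod.Provable {L : ArithLanguage} (d : DeductionMethod L) (α : Set (Sen L))
    (φ : Sen L) : Prop :=
  ∃ π : d.Proof, d.IsProof α π φ

/-- Gödel numberings of the formulas and of the proofs. -/
structure GoedelNumbering (L : ArithLanguage) (d : DeductionMethod L) where
  formula : ∀ n : ℕ, Fml L n → ℕ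
  proof : d.Proof → ℕ
  formula_injective : ∀ n : ℕ, Function.Injective (formula n)
  proof_injective : Function.Injective proof

/-- A generic configuration `(L, Δ₀, B, d, G)`. -/
structure GenericConfiguration where
  L : ArithLanguage
  Δ₀ : FmlClass L
  B : Set (Sen L)
  d : DeductionMethod L
  G : GoedelNumbering L d
  Δ₀_fullyBounded : ∀ (n : ℕ), ∀ φ ∈ Δ₀ n, φ.FullyBounded
  Δ₀_not : ∀ (n : ℕ), ∀ φ ∈ Δ₀ n, φ.not ∈ Δ₀ n
  /-- The graph of addition is defined by a `Δ₀` formula. -/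
  exists_add : ∃ φ ∈ Δ₀ 3, ∀ x y z : ℕ, φ.StdHolds ![x, y, z] ↔ x + y = z
  /-- The graph of multiplication is defined by a `Δ₀` formula. -/
  exists_mult : ∃ φ ∈ Δ₀ 3, ∀ x y z : ℕ, φ.StdHolds ![x, y, z] ↔ x * y = z
  B_true : ∀ φ ∈ B, φ.StdTrue
  B_sigma_one_complete : ∀ φ ∈ SigmaClass Δ₀ 1 0, φ.StdTrue → d.Provable B φ
  /-- The deduction method is complete, for axiom systems that extend the base system. -/
  d_complete : ∀ α : Set (Sen L), B ⊆ α → ∀ φ : Sen L, Entails α φ → d.Provable α φ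
  /-- The indirect-implication property. -/
  d_indirect : ∀ α : Set (Sen L), B ⊆ α → ∀ X Y Z : Sen L, d.Provable α X → d.Provable α Y →
    d.Provable α ((X.and Y).imp Z) → d.Provable α Z

/-! ### Goodness and stability -/

/-- The natural numbers that are smaller than `2 ^ N`; here `N` may be a real number or `∞`. -/
def belowTwoPow (N : EReal) : Set ℕ := {v | ∀ r : ℝ, N ≤ (r : EReal) → (v : ℝ) < (2 : ℝ) ^ r}

/-- `Good(N)`: the sentence is true in Standard-M once its unbounded quantifiers are restricted to
the numbers below `2 ^ N`. -/
def Good {L : ArithLanguage} (N : EReal) (φ : Sen L) : Prop := φ.HoldsIn (belowTwoPow N) ![]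

/-- `♯ θ`: the largest integer `J ≥ 0` for which all sentences of `θ` are `Good(J)`. It is `∞` if
they are `Good(J)` for all `J`, and `-∞` if there is no such `J`. -/
noncomputable def sharp {L : ArithLanguage} (θ : Set (Sen L)) : EReal :=
  sSup {N : EReal | ∃ J : ℕ, N = (J : ℝ) ∧ ∀ φ ∈ θ, Good N φ}

/-- The base-2 logarithm of a Gödel number (with the value `0` at `0`). -/
noncomputable def binLog (p : ℕ) : ℝ := Real.logb 2 p

namespace GenericConfiguration

variable (ξ : GenericConfiguration)

/-- `p` is the Gödel number of a proof of `φ` from the axiom system `α`. -/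
def Proves (α : Set (Sen ξ.L)) (p : ℕ) (φ : Sen ξ.L) : Prop :=
  ∃ π : ξ.d.Proof, ξ.G.proof π = p ∧ ξ.d.IsProof α π φ

/-- `RE-Class(ξ)`: the recursively enumerable sets of `Π₁` sentences. -/
def REClass : Set (Set (Sen ξ.L)) :=
  {θ | θ ⊆ PiClass ξ.Δ₀ 1 0 ∧ REPred (fun n : ℕ => ∃ φ ∈ θ, ξ.G.formula 0 φ = n)}

/-- A-stability. -/
def AStable : Prop :=
  ∀ θ ∈ ξ.REClass, ∀ φ ∈ PiClass ξ.Δ₀ 1 0, ∀ p : ℕ, ξ.Proves (θ ∪ ξ.B) p φ →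
    (binLog p : EReal) ≤ sharp θ + 1 → Good (((1 / 2 : ℝ) : EReal) * sharp θ) φ

/-- E-stability. -/
def EStable : Prop :=
  ∀ θ ∈ ξ.REClass, ∀ φ ∈ SigmaClass ξ.Δ₀ 1 0, ∀ p : ℕ, ξ.Proves (θ ∪ ξ.B) p φ →
    (binLog p : EReal) ≤ sharp θ + 1 → Good (((1 / 2 : ℝ) * ⌊binLog p⌋ - 1 : ℝ) : EReal) φ

/-- EA-stability. -/
def EAStable : Prop := ξ.EStable ∧ ξ.AStable

/-! ### Self-reference and self-justification -/

/-- `α` is consistent under the deduction method of `ξ`. -/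
def Consistent (α : Set (Sen ξ.L)) : Prop :=
  ¬ ∃ φ : Sen ξ.L, ξ.d.Provable α φ ∧ ξ.d.Provable α φ.not

/-- `x` is the Gödel number of a `Π_k` sentence and `y` is that of the `Σ_k` sentence which is its
negation. -/
def NegRel (k x y : ℕ) : Prop :=
  ∃ φ ∈ PiClass ξ.Δ₀ k 0, ξ.G.formula 0 φ = x ∧ ξ.G.formula 0 φ.dual = y

/-- `p` is the Gödel number of a proof from `α` of the sentence with Gödel number `t`. -/
def PrfRel (α : Set (Sen ξ.L)) (t p : ℕ) : Prop :=
  ∃ φ : Sen ξ.L, ξ.G.formula 0 φ = t ∧ ξ.Proves α p φ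

/-- `g` is the Gödel number of a formula `γ` in one free variable, and `p` is the Gödel number of a
proof of the sentence with Gödel number `t` from `β ∪ {γ(ḡ)}`. -/
def SubstPrfRel (β : Set (Sen ξ.L)) (g t p : ℕ) : Prop :=
  ∃ γ : Fml ξ.L 1, ξ.G.formula 1 γ = g ∧ ξ.PrfRel (β ∪ {γ.atNumeral g}) t p

/-- `Ψ` is a `Π₁` sentence `∀ x ∀ y ∀ p ∀ q M(x, y, p, q)` which declares that `α` is Level(`k`)
consistent: its `Δ₀` matrix `M` expresses, in Standard-M, that `p` and `q` are not proofs from `α`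
of a `Π_k` sentence `x` and of the `Σ_k` sentence `y` which is its negation. -/
def DeclaresLevelConsistency (k : ℕ) (α : Set (Sen ξ.L)) (Ψ : Sen ξ.L) : Prop :=
  ∃ M ∈ ξ.Δ₀ 4, Ψ = M.all.all.all.all ∧ ∀ x y p q : ℕ,
    M.StdHolds ![x, y, p, q] ↔ ¬ (ξ.NegRel k x y ∧ ξ.PrfRel α x p ∧ ξ.PrfRel α y q)

/-- `Φ` is a `SelfCons^k(β, d)` sentence: a `Π₁` sentence that declares the Level(`k`) consistency
of `β ∪ {Φ}`, the union of `β` with this very sentence. -/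
def IsSelfCons (k : ℕ) (β : Set (Sen ξ.L)) (Φ : Sen ξ.L) : Prop :=
  ξ.DeclaresLevelConsistency k (β ∪ {Φ}) Φ

/-- `α` is self-justifying (at level `k`): one of its theorems declares its Level(`k`) consistency,
and `α` is in fact consistent. -/
def SelfJustifying (k : ℕ) (α : Set (Sen ξ.L)) : Prop :=
  (∃ Ψ : Sen ξ.L, ξ.d.Provable α Ψ ∧ ξ.DeclaresLevelConsistency k α Ψ) ∧ ξ.Consistent α

/-- The formula `Γ(g) = ∀ x ∀ y ∀ p ∀ q ¬ (Neg(x, y) ∧ SubstPrf(g, x, p) ∧ SubstPrf(g, y, q))`.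
The free variable `g` is the variable `0`, and `x, y, p, q` are the variables `1, 2, 3, 4`. -/
def gammaFormula {L : ArithLanguage} (neg : Fml L 2) (substPrf : Fml L 3) : Fml L 1 :=
  ((neg.rename ![1, 2]).and
    ((substPrf.rename ![0, 1, 3]).and (substPrf.rename ![0, 2, 4]))).not.all.all.all.all

/-- The fixed point `Γ(n̄)`, where `n` is the Gödel number of `Γ(g)`. -/
def gammaFixedPoint (neg : Fml ξ.L 2) (substPrf : Fml ξ.L 3) : Sen ξ.L :=
  (gammaFormula neg substPrf).atNumeral (ξ.G.formula 1 (gammaFormula neg substPrf))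

/-- `Δ₀` encodings of the two syntactic relations from which `SelfCons^k(β, d)` is built. The last
condition holds automatically when `Δ₀` is closed under conjunction and under substitution of
variables and numerals. -/
structure SelfConsEncoding (k : ℕ) (β : Set (Sen ξ.L)) where
  neg : Fml ξ.L 2
  substPrf : Fml ξ.L 3
  neg_mem : neg ∈ ξ.Δ₀ 2
  substPrf_mem : substPrf ∈ ξ.Δ₀ 3
  neg_spec : ∀ x y : ℕ, neg.StdHolds ![x, y] ↔ ξ.NegRel k x y
  substPrf_spec : ∀ g t p : ℕ, substPrf.StdHolds ![g, t, p] ↔ ξ.SubstPrfRel β g t p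
  fixedPoint_mem : ξ.gammaFixedPoint neg substPrf ∈ PiClass ξ.Δ₀ 1 0

/-- The sentence `SelfCons^k(β, d)` that is built from the given encodings. -/
def SelfConsEncoding.selfCons {ξ : GenericConfiguration} {k : ℕ} {β : Set (Sen ξ.L)}
    (E : ξ.SelfConsEncoding k β) : Sen ξ.L :=
  ξ.gammaFixedPoint E.neg E.substPrf

end GenericConfiguration

/-! Consistency: let `Φ` declare the consistency of `B ∪ {Φ}` and suppose that system inconsistent.
It then proves both `Φ` and its dual, so `Φ` is false. Take the least cutoff `2 ^ (J + 1)` at which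
it fails; then `♯{Φ} = J`. The failure supplies a `Π₁` sentence `φ` with proofs `p` of `φ` and `q`
of its dual, both below `2 ^ (J + 1)`, which is exactly the size that stability for `θ = {Φ}`
tolerates. A-stability makes `φ` good at `J / 2`. E-stability makes the dual good at `⌊Log q⌋ / 2 -
1`, which is at most `J / 2`. Goodness of `Π₁` sentences passes to smaller cutoffs
(`AllPrefix.holdsIn_anti`), so `φ` and its dual hold at one cutoff, against `Fml.holdsIn_dual`.
Self-justification follows, as the axiom `Φ` is itself provable.

Fixed point: by injectivity of the Gödel numbering, the code of `Γ(g)` decodes only to `Γ(g)`, so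
`SubstPrf` at that code speaks of proofs from `B` together with `Γ(n̄)` itself. -/

/-! ### Substitution, bounded formulas and duals -/

namespace Fml

variable {L : ArithLanguage}

theorem realize_liftSubst {M : Type} [L.lang.Structure M] {n m : ℕ}
    (σ : Fin n → L.lang.Term (Fin m)) (v : Fin m → M) (x : M) :
    (fun i => (liftSubst σ i).realize (Fin.snoc v x : Fin (m + 1) → M)) =
      (Fin.snoc (fun i => (σ i).realize v) x : Fin (n + 1) → M) := by
  funext i
  refine Fin.lastCases ?_ (fun j => ?_) i
  · simp [liftSubst]
  · simp only [liftSubst, Fin.snoc_castSucc, FirstOrder.Language.Term.realize_relabel]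
    congr 1
    funext k
    simp

theorem holdsIn_subst {M : Type} [L.lang.Structure M] (D : Set M) {n : ℕ} (φ : Fml L n) :
    ∀ {m : ℕ} (σ : Fin n → L.lang.Term (Fin m)) (v : Fin m → M),
      (φ.subst σ).HoldsIn D v ↔ φ.HoldsIn D (fun i => (σ i).realize v) := by
  induction φ with
  | eq s t => intro m σ v; simp [subst, HoldsIn]
  | rel R ts => intro m σ v; simp [subst, HoldsIn]
  | not φ ih => intro m σ v; simp [subst, HoldsIn, ih]
  | and φ ψ ih₁ ih₂ => intro m σ v; simp [subst, HoldsIn, ih₁, ih₂]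
  | or φ ψ ih₁ ih₂ => intro m σ v; simp [subst, HoldsIn, ih₁, ih₂]
  | imp φ ψ ih₁ ih₂ => intro m σ v; simp [subst, HoldsIn, ih₁, ih₂]
  | ball t φ ih => intro m σ v; simp [subst, HoldsIn, ih, realize_liftSubst]
  | bex t φ ih => intro m σ v; simp [subst, HoldsIn, ih, realize_liftSubst]
  | all φ ih => intro m σ v; simp [subst, HoldsIn, ih, realize_liftSubst]
  | ex φ ih => intro m σ v; simp [subst, HoldsIn, ih, realize_liftSubst]

theorem stdHolds_rename {n m : ℕ} (φ : Fml L n) (f : Fin n → Fin m) (v : Fin m → ℕ) :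
    (φ.rename f).StdHolds v ↔ φ.StdHolds (fun i => v (f i)) :=
  holdsIn_subst _ φ _ v

/-- Truth of a fully bounded formula does not depend on the range of the unbounded quantifiers. -/
theorem FullyBounded.holdsIn_iff {M : Type} [L.lang.Structure M] (D E : Set M) {n : ℕ}
    {φ : Fml L n} (h : φ.FullyBounded) (v : Fin n → M) : φ.HoldsIn D v ↔ φ.HoldsIn E v := by
  induction φ with
  | eq s t => rfl
  | rel R ts => rfl
  | not φ ih => exact not_congr (ih h v)
  | and φ ψ ih₁ ih₂ => exact and_congr (ih₁ h.1 v) (ih₂ h.2 v)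
  | or φ ψ ih₁ ih₂ => exact or_congr (ih₁ h.1 v) (ih₂ h.2 v)
  | imp φ ψ ih₁ ih₂ => exact imp_congr (ih₁ h.1 v) (ih₂ h.2 v)
  | ball t φ ih => exact forall_congr' fun x => imp_congr_right fun _ => ih h _
  | bex t φ ih => exact exists_congr fun x => and_congr_right fun _ => ih h _
  | all φ ih => exact h.elim
  | ex φ ih => exact h.elim

/-- The same range `D` serves both quantifiers, so dualizing is exact negation at every cutoff, not
only in the full model. -/
theorem holdsIn_dual {M : Type} [L.lang.Structure M] (D : Set M) {n : ℕ} (φ : Fml L n)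
    (v : Fin n → M) : φ.dual.HoldsIn D v ↔ ¬ φ.HoldsIn D v := by
  induction φ with
  | all φ ih => simp [dual, HoldsIn, ih]
  | ex φ ih => simp [dual, HoldsIn, ih]
  | _ => simp [dual, HoldsIn]

theorem dual_ne (φ : Sen L) : φ.dual ≠ φ := fun h => by
  have := holdsIn_dual (Set.univ : Set ℕ) φ ![]
  rw [h] at this
  exact iff_not_self this

theorem FullyBounded.dual_eq {n : ℕ} {φ : Fml L n} (h : φ.FullyBounded) : φ.dual = φ.not := by
  cases φ <;> first | rfl | exact h.elim

theorem snoc_four (x y p q : ℕ) : (Fin.snoc (Fin.snoc (Fin.snoc (Fin.snoc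
    (![] : Fin 0 → ℕ) x : Fin 1 → ℕ) y : Fin 2 → ℕ) p : Fin 3 → ℕ) q : Fin 4 → ℕ) =
      ![x, y, p, q] := by
  funext i
  fin_cases i <;> rfl

theorem holdsIn_all_four {D : Set ℕ} {M : Fml L 4} :
    (M.all.all.all.all : Sen L).HoldsIn D ![] ↔
      ∀ x ∈ D, ∀ y ∈ D, ∀ p ∈ D, ∀ q ∈ D, M.HoldsIn D ![x, y, p, q] := by
  simp only [HoldsIn, ← snoc_four]

end Fml

/-! ### Quantifier prefixes over a fully bounded class -/

section Prefixes

variable {L : ArithLanguage} {C : FmlClass L}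

/-- A formula that begins with an unbounded quantifier cannot lie in `C`, so that quantifier must
come from the prefix. -/
theorem AllPrefix.of_all (hC : ∀ n, ∀ φ ∈ C n, φ.FullyBounded) {n : ℕ} {φ : Fml L (n + 1)}
    (h : AllPrefix C n φ.all) : AllPrefix C (n + 1) φ := by
  cases h with
  | base h => exact (hC _ _ h).elim
  | all h => exact h

theorem AllPrefix.mem_of_not {n : ℕ} {φ : Fml L n} (h : AllPrefix C n φ.not) : φ.not ∈ C n := by
  cases h with
  | base h => exact h

theorem AllPrefix.dual (hC : ∀ n, ∀ φ ∈ C n, φ.FullyBounded)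
    (hnot : ∀ n, ∀ φ ∈ C n, φ.not ∈ C n) {n : ℕ} {φ : Fml L n} (h : AllPrefix C n φ) :
    ExPrefix C n φ.dual := by
  induction h with
  | base h =>
    rw [(hC _ _ h).dual_eq]
    exact .base (hnot _ _ h)
  | all _ ih => exact .ex ih

/-- Shrinking the range weakens each universal quantifier and leaves the bounded matrix unchanged.
-/
theorem AllPrefix.holdsIn_anti (hC : ∀ n, ∀ φ ∈ C n, φ.FullyBounded) {M : Type}
    [L.lang.Structure M] {D E : Set M} (hDE : D ⊆ E) {n : ℕ} {φ : Fml L n}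
    (h : AllPrefix C n φ) (v : Fin n → M) (hE : φ.HoldsIn E v) : φ.HoldsIn D v := by
  induction h with
  | base h => exact ((hC _ _ h).holdsIn_iff D E v).2 hE
  | all _ ih => exact fun x hx => ih _ (hE x (hDE hx))

end Prefixes

/-! ### Cutoffs, `♯` and logarithms -/

theorem belowTwoPow_mono : Monotone belowTwoPow :=
  fun _ _ h _ hv r hr => hv r (h.trans hr)

theorem mem_belowTwoPow_natCast {J v : ℕ} :
    v ∈ belowTwoPow (((J : ℝ) : EReal)) ↔ v < 2 ^ J := by
  constructor
  · intro h
    have := h J le_rfl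
    rw [Real.rpow_natCast] at this
    exact_mod_cast this
  · intro h r hr
    have hr' : (J : ℝ) ≤ r := by exact_mod_cast hr
    calc (v : ℝ) < 2 ^ J := by exact_mod_cast h
      _ = (2 : ℝ) ^ (J : ℝ) := (Real.rpow_natCast _ _).symm
      _ ≤ 2 ^ r := Real.rpow_le_rpow_of_exponent_le one_le_two hr'

theorem sharp_eq_of_good_of_not_good {L : ArithLanguage} {θ : Set (Sen L)} {J : ℕ}
    (hJ : ∀ φ ∈ θ, Good ((J : ℝ) : EReal) φ)
    (hlt : ∀ K : ℕ, J < K → ∃ φ ∈ θ, ¬ Good ((K : ℝ) : EReal) φ) :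
    sharp θ = ((J : ℝ) : EReal) := by
  refine IsGreatest.csSup_eq ⟨⟨J, rfl, hJ⟩, ?_⟩
  rintro _ ⟨K, rfl, hK⟩
  by_contra hlt'
  have hJK : J < K := by
    by_contra hle
    exact hlt' (by exact_mod_cast not_lt.1 hle)
  obtain ⟨φ, hφ, hn⟩ := hlt K hJK
  exact hn (hK φ hφ)

theorem binLog_lt_of_lt_two_pow {p K : ℕ} (hK : 0 < K) (hp : p < 2 ^ K) : binLog p < K := by
  -- The convention `Log 0 = 0` is why `K` must be positive.
  rcases Nat.eq_zero_or_pos p with rfl | hpos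
  · simpa [binLog] using hK
  · rw [binLog, Real.logb_lt_iff_lt_rpow one_lt_two (by exact_mod_cast hpos), Real.rpow_natCast]
    exact_mod_cast hp

/-! ### Provability, the fixed point and consistency -/

namespace GenericConfiguration

variable {ξ : GenericConfiguration}

theorem provable_of_mem {α : Set (Sen ξ.L)} (hα : ξ.B ⊆ α) {φ : Sen ξ.L} (h : φ ∈ α) :
    ξ.d.Provable α φ :=
  ξ.d_complete α hα φ fun _ _ _ hM => hM φ h

/-- Explosion without modus ponens: `(φ ∧ ¬φ) → ψ` is valid, hence provable by completeness, and the
indirect-implication property detaches `ψ`. -/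
theorem provable_of_not_consistent {α : Set (Sen ξ.L)} (hα : ξ.B ⊆ α) (h : ¬ ξ.Consistent α)
    (ψ : Sen ξ.L) : ξ.d.Provable α ψ := by
  obtain ⟨φ, h₁, h₂⟩ := not_not.1 h
  exact ξ.d_indirect α hα _ _ ψ h₁ h₂ (ξ.d_complete α hα _ fun _ _ _ _ hc => (hc.2 hc.1).elim)

theorem singleton_mem_REClass {φ : Sen ξ.L} (h : φ ∈ PiClass ξ.Δ₀ 1 0) : {φ} ∈ ξ.REClass := by
  refine ⟨Set.singleton_subset_iff.2 h, ?_⟩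
  have hc : ComputablePred fun n : ℕ => n = ξ.G.formula 0 φ :=
    ⟨inferInstance, (Primrec.eq.comp Primrec.id (Primrec.const _)).decide.to_comp⟩
  refine hc.to_re.of_eq fun n => ?_
  simp [eq_comm]

theorem proves_of_prfRel_formula {α : Set (Sen ξ.L)} {φ : Sen ξ.L} {p : ℕ}
    (h : ξ.PrfRel α (ξ.G.formula 0 φ) p) : ξ.Proves α p φ := by
  obtain ⟨ψ, hψ, hp⟩ := h
  rwa [ξ.G.formula_injective 0 hψ] at hp

theorem substPrfRel_formula (β : Set (Sen ξ.L)) (γ : Fml ξ.L 1) (t p : ℕ) :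
    ξ.SubstPrfRel β (ξ.G.formula 1 γ) t p ↔
      ξ.PrfRel (β ∪ {γ.atNumeral (ξ.G.formula 1 γ)}) t p := by
  constructor
  · rintro ⟨γ', hγ', h⟩
    rwa [ξ.G.formula_injective 1 hγ'] at h
  · exact fun h => ⟨γ, rfl, h⟩

theorem SelfConsEncoding.isSelfCons {k : ℕ} {β : Set (Sen ξ.L)} (E : ξ.SelfConsEncoding k β) :
    ξ.IsSelfCons k β E.selfCons := by
  have hb := ξ.Δ₀_fullyBounded
  set n := ξ.G.formula 1 (gammaFormula E.neg E.substPrf)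
  -- Peeling the four universal quantifiers off the fixed point leaves a negation, which can only be
  -- a `Δ₀` matrix.
  refine ⟨_, AllPrefix.mem_of_not (AllPrefix.of_all hb (AllPrefix.of_all hb
    (AllPrefix.of_all hb (AllPrefix.of_all hb E.fixedPoint_mem)))), rfl, fun x y p q => ?_⟩
  have hnum : ((ξ.L.numeral n).relabel (fun e => e.elim) : ξ.L.lang.Term (Fin 0)).realize
      (![] : Fin 0 → ℕ) = n := by
    rw [FirstOrder.Language.Term.realize_relabel, Subsingleton.elim ((![] : Fin 0 → ℕ) ∘ _)]
    exact ξ.L.numeral_value n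
  set w : Fin 5 → ℕ := ![n, x, y, p, q]
  -- Carried under the four quantifiers, the substitution puts `n` in place of `g` and fixes `x, y,
  -- p, q`.
  have hval : (fun i => (Fml.liftSubst (Fml.liftSubst (Fml.liftSubst (Fml.liftSubst
      (fun _ : Fin 1 => ((ξ.L.numeral n).relabel (fun e => e.elim) : ξ.L.lang.Term (Fin 0))))))
        i).realize ![x, y, p, q]) = w := by
    rw [← Fml.snoc_four]
    simp only [Fml.realize_liftSubst, hnum]
    funext i
    fin_cases i <;> rfl
  have hprf : ∀ t r : ℕ, E.substPrf.StdHolds ![n, t, r] ↔ ξ.PrfRel (β ∪ {E.selfCons}) t r :=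
    fun t r => (E.substPrf_spec n t r).trans (substPrfRel_formula β _ t r)
  have hneg : (E.neg.rename ![1, 2]).StdHolds w ↔ ξ.NegRel k x y := by
    rw [Fml.stdHolds_rename, ← E.neg_spec]
    exact iff_of_eq (congrArg _ (by funext i; fin_cases i <;> rfl))
  have hp : (E.substPrf.rename ![0, 1, 3]).StdHolds w ↔ ξ.PrfRel (β ∪ {E.selfCons}) x p := by
    rw [Fml.stdHolds_rename, ← hprf]
    exact iff_of_eq (congrArg _ (by funext i; fin_cases i <;> rfl))
  have hq : (E.substPrf.rename ![0, 2, 4]).StdHolds w ↔ ξ.PrfRel (β ∪ {E.selfCons}) y q := by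
    rw [Fml.stdHolds_rename, ← hprf]
    exact iff_of_eq (congrArg _ (by funext i; fin_cases i <;> rfl))
  rw [← hneg, ← hp, ← hq, ← hval]
  exact Fml.holdsIn_subst (Set.univ : Set ℕ) (((E.neg.rename ![1, 2] : Fml ξ.L 5).and
    ((E.substPrf.rename ![0, 1, 3]).and (E.substPrf.rename ![0, 2, 4]))).not) _ _

theorem IsSelfCons.consistent (hξ : ξ.EAStable) {Φ : Sen ξ.L} (hΦ : ξ.IsSelfCons 1 ξ.B Φ) :
    ξ.Consistent (ξ.B ∪ {Φ}) := by
  obtain ⟨M, hM, rfl, hspec⟩ := hΦ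
  set Φ : Sen ξ.L := M.all.all.all.all with hΦdef
  have hb := ξ.Δ₀_fullyBounded
  have hPi : Φ ∈ PiClass ξ.Δ₀ 1 0 := .all (.all (.all (.all (.base hM))))
  have hgood : ∀ J : ℕ, Good ((J : ℝ) : EReal) Φ ↔ ∀ x < 2 ^ J, ∀ y < 2 ^ J, ∀ p < 2 ^ J,
      ∀ q < 2 ^ J, M.StdHolds ![x, y, p, q] := fun J => by
    simp only [Good, hΦdef, Fml.holdsIn_all_four, mem_belowTwoPow_natCast, Fml.StdHolds,
      (hb _ _ hM).holdsIn_iff (belowTwoPow ((J : ℝ) : EReal)) Set.univ]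
  by_contra hinc
  have hprov := provable_of_not_consistent Set.subset_union_left hinc
  obtain ⟨π, hπ⟩ := hprov Φ
  obtain ⟨ρ, hρ⟩ := hprov Φ.dual
  have hbad : ∃ J : ℕ, ¬ Good ((J : ℝ) : EReal) Φ := by
    by_contra! hall
    set x := ξ.G.formula 0 Φ
    set y := ξ.G.formula 0 Φ.dual
    set p := ξ.G.proof π
    set q := ξ.G.proof ρ
    -- A cutoff exponent that exceeds neither code nor proof number need be found exactly: `s < 2 ^
    -- s` for the sum `s` of all four suffices.
    have hlt : x + y + p + q < 2 ^ (x + y + p + q) := Nat.lt_two_pow_self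
    exact (hspec x y p q).1 ((hgood _).1 (hall (x + y + p + q)) x (by omega) y (by omega)
        p (by omega) q (by omega))
      ⟨⟨Φ, hPi, rfl, rfl⟩, ⟨Φ, rfl, π, rfl, hπ⟩, ⟨Φ.dual, rfl, ρ, rfl, hρ⟩⟩
  classical
  obtain ⟨K, hK, hmin⟩ : ∃ K : ℕ, ¬ Good ((K : ℝ) : EReal) Φ ∧
      ∀ J < K, Good ((J : ℝ) : EReal) Φ :=
    ⟨Nat.find hbad, Nat.find_spec hbad, fun J hJ => not_not.1 (Nat.find_min hbad hJ)⟩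
  have hfail := hK
  rw [hgood] at hfail
  push Not at hfail
  obtain ⟨x, hx, y, hy, p, hp, q, hq, hMf⟩ := hfail
  rw [hspec, not_not] at hMf
  obtain ⟨⟨φ, hφ, rfl, rfl⟩, hpφ, hqφ⟩ := hMf
  -- The two Gödel numbers differ, so that `Φ` is `Good(0)` and `♯{Φ}` is finite.
  obtain ⟨J, rfl⟩ : ∃ J, K = J + 1 := by
    refine Nat.exists_eq_succ_of_ne_zero ?_
    rintro rfl
    exact φ.dual_ne (ξ.G.formula_injective 0 (by omega))
  have hsharp : sharp {Φ} = ((J : ℝ) : EReal) := by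
    refine sharp_eq_of_good_of_not_good (by simpa using hmin J (by omega)) fun K hJK =>
      ⟨Φ, rfl, fun hG => hK (AllPrefix.holdsIn_anti hb (belowTwoPow_mono ?_) hPi _ hG)⟩
    exact_mod_cast hJK
  -- Minimality of `J + 1` meets the `+ 1` in the stability conditions: witnesses below the failing
  -- cutoff are still short enough.
  have hlog : ∀ r < 2 ^ (J + 1), (binLog r : EReal) ≤ sharp {Φ} + 1 := fun r hr => by
    rw [hsharp]
    exact_mod_cast (binLog_lt_of_lt_two_pow J.succ_pos hr).le
  have hRE := singleton_mem_REClass hPi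
  rw [Set.union_comm] at hpφ hqφ
  have hA := hξ.2 _ hRE φ hφ p (proves_of_prfRel_formula hpφ) (hlog p hp)
  have hE := hξ.1 _ hRE φ.dual (AllPrefix.dual hb ξ.Δ₀_not hφ) q (proves_of_prfRel_formula hqφ)
    (hlog q hq)
  refine (Fml.holdsIn_dual _ φ _).1 hE
    (AllPrefix.holdsIn_anti hb (belowTwoPow_mono ?_) hφ _ hA)
  rw [hsharp, ← EReal.coe_mul, EReal.coe_le_coe_iff]
  -- The strict bound `Log q < J + 1` rounds down to `J`, which puts the E-stability exponent below
  -- `J / 2`.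
  have hfl : ⌊binLog q⌋ ≤ (J : ℤ) := by
    have := Int.floor_lt.2 (show binLog q < ((J + 1 : ℤ) : ℝ) by
      exact_mod_cast binLog_lt_of_lt_two_pow J.succ_pos hq)
    omega
  have hfl' : (⌊binLog q⌋ : ℝ) ≤ J := by exact_mod_cast hfl
  linarith

end GenericConfiguration

theorem mainTheorem1 (ξ : GenericConfiguration) (hξ : ξ.EAStable) :
    (∀ E : ξ.SelfConsEncoding 1 ξ.B, ξ.IsSelfCons 1 ξ.B E.selfCons) ∧
      ∀ Φ : Sen ξ.L, ξ.IsSelfCons 1 ξ.B Φ →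
        ξ.Consistent (ξ.B ∪ {Φ}) ∧ ξ.SelfJustifying 1 (ξ.B ∪ {Φ}) :=
  ⟨fun E => E.isSelfCons, fun Φ hΦ =>
    have hcon := GenericConfiguration.IsSelfCons.consistent hξ hΦ
    ⟨hcon, ⟨Φ, GenericConfiguration.provable_of_mem Set.subset_union_left (Or.inr rfl), hΦ⟩,
      hcon⟩⟩
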